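/- Let $q$ be a power of an odd prime and let $\mathbb F_q$ be the finite field with $q$ elements. Every multiplicative character $\chi:\mathbb F_q^\times\to\mathbb C^\times$, including the trivial character $\epsilon$, is extended by $\chi(0)=0$, and $\phi$ denotes the quadratic character. For multiplicative characters $A,B$ put $$J(A,B)=\sum_{x\in\mathbb F_q}A(x)B(1-x),\qquad \binom{A}{B}=\frac{B(-1)}{q}J(A,\overline B),$$ and let $${}_3F_2(x)=\frac{q}{q-1}\sum_{\chi}\binom{\phi\chi}{\chi}\binom{\phi\chi}{\epsilon\chi}\binom{\phi\chi}{\epsilon\chi}\,\chi(x)\qquad(x\in\mathbb F_q)$$ be Greene's Gaussian hypergeometric function with upper parameters $\phi,\phi,\phi$ and lower parameters $\epsilon,\epsilon$, the sum being over all multiplicative characters $\chi$ of $\mathbb F_q$. The trace of Frobenius of an elliptic curve $E$ over $\mathbb F_q$ is $q+1-\#E(\mathbb F_q)$, where the point at infinity is counted. Let $a_\lambda(q)$ be the trace of Frobenius of the Legendre curve $y^2=x(x-1)(x-\lambda)$ for $\lambda\in\mathbb F_q\setminus\{0,1\}$, and let $a'_\lambda(q)$ be the trace of Frobenius of the Clausen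 curve $y^2=(x-1)(x^2+\lambda)$ for $\lambda\in\mathbb F_q\setminus\{0,-1\}$. Then the following three identities hold: 1. $\displaystyle\sum_{\lambda\in\mathbb F_q\setminus\{0,1\}}a_\lambda(q)+\phi(-1)=-1$; 2. $\displaystyle\sum_{\lambda\in\mathbb F_q\setminus\{0,-1\}}\phi(1+\lambda)\,a'_\lambda(q)^2+q+q^2\,{}_3F_2(1)=-1$; 3. $\displaystyle\sum_{\lambda\in\mathbb F_q\setminus\{0,-1\}}\phi(\lambda)\,a'_\lambda(q)^2+q\,\phi(-1)+q^2\,{}_3F_2(1)=-\phi(-1)$. -/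

import Mathlib

open scoped BigOperators

namespace GaussHyp

/-- The multiplicative characters of a finite field form a finite set. -/
noncomputable instance instFintypeMulChar (F : Type*) [Field F] [Fintype F] :
    Fintype (MulChar F ℂ) :=
  Fintype.ofFinite _

/-- The quadratic character `φ` with complex values; `φ 0 = 0`. -/
noncomputable def phi (F : Type*) [Field F] [Fintype F] [DecidableEq F] : MulChar F ℂ :=
  (quadraticChar F).ringHomComp (Int.castRingHom ℂ)

/-- The binomial coefficient of two multiplicative characters,
`(A choose B) = (B(-1) / q) * J(A, B⁻¹)`. All characters, the trivial one included,
take the value `0` at `0`. -/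
noncomputable def charBinom {F : Type*} [Field F] [Fintype F] (A B : MulChar F ℂ) : ℂ :=
  B (-1) / (Fintype.card F : ℂ) * jacobiSum A B⁻¹

/-- Greene's Gaussian hypergeometric series `ₙ₊₁Fₙ(A₀, A₁, …, Aₙ; B₁, …, Bₙ | x)`.
The lower parameter `Bᵢ₊₁` is `B i` and `Aᵢ₊₁` is `A i.succ`. -/
noncomputable def hyp {F : Type*} [Field F] [Fintype F] {n : ℕ}
    (A : Fin (n + 1) → MulChar F ℂ) (B : Fin n → MulChar F ℂ) (x : F) : ℂ :=
  (Fintype.card F : ℂ) / ((Fintype.card F : ℂ) - 1) *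
    ∑ χ : MulChar F ℂ,
      charBinom (A 0 * χ) χ * (∏ i : Fin n, charBinom (A i.succ * χ) (B i * χ)) * χ x

/-- The series `ₙ₊₁Fₙ(φ, …, φ; ε, …, ε | x)`, written `ₙ₊₁Fₙ(x)`. -/
noncomputable def hypPhi {F : Type*} [Field F] [Fintype F] [DecidableEq F] (n : ℕ) (x : F) : ℂ :=
  hyp (fun _ : Fin (n + 1) => phi F) (fun _ : Fin n => 1) x

/-- The Legendre curve `y² = x (x - 1) (x - l)`. -/
def legendreCurve {F : Type*} [Field F] (l : F) : WeierstrassCurve F where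
  a₁ := 0
  a₂ := -(1 + l)
  a₃ := 0
  a₄ := l
  a₆ := 0

/-- The Clausen curve `y² = (x - 1) (x² + l)`. -/
def clausenCurve {F : Type*} [Field F] (l : F) : WeierstrassCurve F where
  a₁ := 0
  a₂ := -1
  a₃ := 0
  a₄ := l
  a₆ := -l

theorem legendreCurve_equation_iff {F : Type*} [Field F] (l x y : F) :
    (legendreCurve l).toAffine.Equation x y ↔ y ^ 2 = x * (x - 1) * (x - l) := by
  rw [WeierstrassCurve.Affine.equation_iff]
  simp only [legendreCurve]
  constructor <;> intro h <;> linear_combination h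

theorem clausenCurve_equation_iff {F : Type*} [Field F] (l x y : F) :
    (clausenCurve l).toAffine.Equation x y ↔ y ^ 2 = (x - 1) * (x ^ 2 + l) := by
  rw [WeierstrassCurve.Affine.equation_iff]
  simp only [clausenCurve]
  constructor <;> intro h <;> linear_combination h

/-- The discriminant does not vanish for `l ≠ 0, 1` in odd characteristic. -/
theorem legendreCurve_Δ {F : Type*} [Field F] (l : F) :
    (legendreCurve l).Δ = 16 * (l ^ 2 * (l - 1) ^ 2) := by
  simp only [legendreCurve, WeierstrassCurve.Δ, WeierstrassCurve.b₂, WeierstrassCurve.b₄,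
    WeierstrassCurve.b₆, WeierstrassCurve.b₈]
  ring

/-- The discriminant does not vanish for `l ≠ 0, -1` in odd characteristic. -/
theorem clausenCurve_Δ {F : Type*} [Field F] (l : F) :
    (clausenCurve l).Δ = -64 * (l * (l + 1) ^ 2) := by
  simp only [clausenCurve, WeierstrassCurve.Δ, WeierstrassCurve.b₂, WeierstrassCurve.b₄,
    WeierstrassCurve.b₆, WeierstrassCurve.b₈]
  ring

/-- The trace of Frobenius `q + 1 - #E(𝔽_q)` of an elliptic curve over `𝔽_q`; the points
include the point at infinity. -/
noncomputable def frobTrace {F : Type*} [Field F] [Fintype F] (E : WeierstrassCurve F) : ℤ :=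
  (Fintype.card F : ℤ) + 1 - (Nat.card E.toAffine.Point : ℤ)

/-- The trace `a_l(q)` of the Legendre curve. -/
noncomputable def legendreTrace {F : Type*} [Field F] [Fintype F] (l : F) : ℤ :=
  frobTrace (legendreCurve l)

/-- The trace `a'_l(q)` of the Clausen curve. -/
noncomputable def clausenTrace {F : Type*} [Field F] [Fintype F] (l : F) : ℤ :=
  frobTrace (clausenCurve l)

/-- A Weierstrass curve over a finite field has finitely many points, so that the number of
points in `frobTrace` is a genuine one. -/
theorem finite_point {F : Type*} [Field F] [Fintype F] (E : WeierstrassCurve F) :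
    Finite E.toAffine.Point := by
  let f : E.toAffine.Point → Option (F × F) := fun P => match P with
    | .zero => none
    | .some x y _ => some (x, y)
  refine Finite.of_injective f ?_
  rintro (_ | ⟨x, y, h⟩) (_ | ⟨x', y', h'⟩) hP <;> simp_all [f]

end GaussHyp

/-! Write φ for the quadratic character. Every trace is minus a sum of φ over the values of a cubic.
The Legendre cubic is linear in λ, so summing over λ first gives identity 1.

For identities 2 and 3, the square of the Clausen sum is a double sum over x, y of a symmetric
function. In terms of s = x + y and p = x y, each pair (s, p) carries the weight 1 + φ(s² - 4p). The
summand 1 contributes q (`sum_quadraticChar_linear_mul_norm`). The summand φ(s² - 4p) contributes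
`surfaceSum` (`sum_quadraticChar_linear_mul_norm_mul_disc`), by root counts in a pencil of
quadratics and a 2-isogeny. Hence a'_λ² = q + `surfaceSum` λ.

In `surfaceSum`, λ enters through one linear factor only, so the weighted sums over λ are
elementary: they leave -`surfaceSumOne` plus terms from the excluded λ. Orthogonality of characters
gives `surfaceSumOne` = q² ₃F₂(1). -/

open scoped BigOperators

/-! ### Quadratic character sums and root counts -/

section QuadraticCharacterSums

variable {F : Type*} [Field F] [Fintype F]

theorem sum_comp_mul_add {M : Type*} [AddCommMonoid M] {a : F} (ha : a ≠ 0) (b : F) (f : F → M) :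
    ∑ x, f (a * x + b) = ∑ x, f x := by
  refine Function.Bijective.sum_comp (e := fun x => a * x + b) ?_ f
  refine Finite.injective_iff_bijective.mp fun x y h => ?_
  exact mul_left_cancel₀ ha (add_right_cancel h)

theorem sum_comp_inv {M : Type*} [AddCommMonoid M] (f : F → M) :
    ∑ x, f x⁻¹ = ∑ x, f x :=
  Function.Bijective.sum_comp inv_involutive.bijective f

variable [DecidableEq F]

theorem sum_comp_eq_sum_mul_card {α : Type*} [Fintype α] (f : α → F) (g : F → ℤ) :
    ∑ x, g (f x) = ∑ v, g v * ((Finset.univ.filter fun x => f x = v).card : ℤ) := by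
  rw [← Finset.sum_fiberwise Finset.univ f]
  refine Finset.sum_congr rfl fun v _ => ?_
  rw [Finset.sum_congr rfl (g := fun _ => g v) (by intro x hx; simp_all)]
  simp [mul_comm]

theorem sum_filter_ne_ne (a b : F) (hab : a ≠ b) (f : F → ℤ) :
    ∑ x ∈ Finset.univ.filter (fun x : F => x ≠ a ∧ x ≠ b), f x = ∑ x, f x - f a - f b := by
  have h : Finset.univ.filter (fun x : F => x ≠ a ∧ x ≠ b) = (Finset.univ.erase a).erase b := by
    ext x; simp [and_comm]
  rw [h, Finset.sum_erase_eq_sub (by simpa using hab.symm), Finset.sum_erase_eq_sub (by simp)]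

theorem quadraticChar_mul_sq (a : F) {b : F} (hb : b ≠ 0) :
    quadraticChar F (a * b ^ 2) = quadraticChar F a := by
  rw [map_mul, quadraticChar_sq_one' hb, mul_one]

theorem quadraticChar_sq_mul {b : F} (hb : b ≠ 0) (a : F) :
    quadraticChar F (b ^ 2 * a) = quadraticChar F a := by
  rw [map_mul, quadraticChar_sq_one' hb, one_mul]

/-- Completing the square: x ↦ 2ax + b carries the roots to the square roots of the discriminant. -/
theorem card_quadratic_roots (hF : ringChar F ≠ 2) {a : F} (ha : a ≠ 0) (b c : F) :
    ((Finset.univ.filter fun x : F => a * x ^ 2 + b * x + c = 0).card : ℤ)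
      = 1 + quadraticChar F (b ^ 2 - 4 * a * c) := by
  have h2 := Ring.two_ne_zero hF
  have h := quadraticChar_card_sqrts hF (b ^ 2 - 4 * a * c)
  rw [add_comm, ← h]
  congr 1
  refine Finset.card_bij (fun x _ => 2 * a * x + b) ?_ ?_ ?_
  · intro x hx
    simp only [Finset.mem_filter, Finset.mem_univ, true_and] at hx
    simp only [Set.mem_toFinset, Set.mem_ofPred_eq]
    linear_combination 4 * a * hx
  · intro x _ y _ hxy
    exact mul_left_cancel₀ (mul_ne_zero h2 ha) (add_right_cancel hxy)
  · intro y hy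
    simp only [Set.mem_toFinset, Set.mem_ofPred_eq] at hy
    refine ⟨(y - b) / (2 * a), ?_, by field_simp; ring⟩
    simp only [Finset.mem_filter, Finset.mem_univ, true_and]
    field_simp
    linear_combination hy

theorem card_monic_quadratic_roots (hF : ringChar F ≠ 2) (b c : F) :
    ((Finset.univ.filter fun x : F => x ^ 2 + b * x + c = 0).card : ℤ)
      = 1 + quadraticChar F (b ^ 2 - 4 * c) := by
  simpa using card_quadratic_roots hF one_ne_zero b c

theorem sum_quadraticChar_linear (hF : ringChar F ≠ 2) {a : F} (ha : a ≠ 0) (b : F) :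
    ∑ x, quadraticChar F (a * x + b) = 0 := by
  rw [sum_comp_mul_add ha b (fun x => quadraticChar F x), quadraticChar_sum_zero hF]

theorem sum_quadraticChar_mul_add (hF : ringChar F ≠ 2) {d : F} (hd : d ≠ 0) :
    ∑ x, quadraticChar F (x * (x + d)) = -1 := by
  -- Divide by x². At x = 0 the convention 0⁻¹ = 0 produces φ(1) = 1, which is subtracted.
  have h : ∀ x : F, quadraticChar F (x * (x + d))
      = quadraticChar F (d * x⁻¹ + 1) - if x = 0 then 1 else 0 := by
    intro x
    by_cases hx : x = 0
    · simp [hx]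
    · rw [if_neg hx, sub_zero, ← quadraticChar_sq_mul hx (d * x⁻¹ + 1)]
      congr 1
      field_simp
      ring
  rw [Finset.sum_congr rfl fun x _ => h x, Finset.sum_sub_distrib,
    sum_comp_inv (fun x => quadraticChar F (d * x + 1)), sum_quadraticChar_linear hF hd]
  simp

theorem sum_quadraticChar_sq_add (hF : ringChar F ≠ 2) {c : F} (hc : c ≠ 0) :
    ∑ x, quadraticChar F (x ^ 2 + c) = -1 := by
  rw [sum_comp_eq_sum_mul_card (fun x : F => x ^ 2 + c) (fun v => quadraticChar F v)]
  have h : ∀ v : F, ((Finset.univ.filter fun x : F => x ^ 2 + c = v).card : ℤ)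
      = 1 + quadraticChar F (v - c) := by
    intro v
    have := card_monic_quadratic_roots hF 0 (c - v)
    have e : (0 : F) ^ 2 - 4 * (c - v) = (v - c) * 2 ^ 2 := by ring
    rw [e, quadraticChar_mul_sq _ (Ring.two_ne_zero hF)] at this
    rw [← this]
    congr 2
    ext x
    simp only [zero_mul, add_zero, ← add_sub_assoc, sub_eq_zero]
  simp only [h, mul_add, mul_one, Finset.sum_add_distrib, quadraticChar_sum_zero hF, ← map_mul,
    zero_add]
  have := sum_quadraticChar_mul_add hF (neg_ne_zero.mpr hc)
  simpa only [← sub_eq_add_neg] using this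

/-- The character sums of two curves `y² = x (x² + a x + b)` related by a `2`-isogeny agree. -/
theorem sum_quadraticChar_two_isogeny (hF : ringChar F ≠ 2) (a : F) {b : F} (hb : b ≠ 0) :
    ∑ w, quadraticChar F (w * (w ^ 2 + a * w + b))
      = ∑ v, quadraticChar F (v * ((v - a) ^ 2 - 4 * b)) := by
  have h0 : ∑ w, quadraticChar F (w * (w ^ 2 + a * w + b))
      = ∑ w ∈ Finset.univ.filter (fun w : F => w ≠ 0), quadraticChar F (w + a + b / w) := by
    rw [Finset.sum_filter]
    refine Finset.sum_congr rfl fun w _ => ?_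
    by_cases hw : w = 0
    · simp [hw]
    · rw [if_pos hw, ← quadraticChar_sq_mul hw (w + a + b / w)]
      congr 1
      field_simp
  rw [h0, Finset.sum_subtype (p := fun w : F => w ≠ 0) _ (by simp),
    sum_comp_eq_sum_mul_card (fun w : {w : F // w ≠ 0} => (w : F) + a + b / w)
      (fun v => quadraticChar F v)]
  have h : ∀ v : F,
      ((Finset.univ.filter fun w : {w : F // w ≠ 0} => (w : F) + a + b / w = v).card : ℤ)
        = 1 + quadraticChar F ((v - a) ^ 2 - 4 * b) := by
    intro v
    have e : (v - a) ^ 2 - 4 * b = (a - v) ^ 2 - 4 * b := by ring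
    rw [e, ← card_monic_quadratic_roots hF (a - v) b]
    congr 1
    refine Finset.card_bij (fun w _ => (w : F)) ?_ (fun _ _ _ _ h => Subtype.ext h) ?_
    · rintro ⟨w, hw⟩ h
      simp only [Finset.mem_filter, Finset.mem_univ, true_and] at h ⊢
      field_simp at h
      linear_combination h
    · intro w hw
      simp only [Finset.mem_filter, Finset.mem_univ, true_and] at hw
      have hw0 : w ≠ 0 := by
        rintro rfl
        exact hb (by linear_combination hw)
      refine ⟨⟨w, hw0⟩, ?_, rfl⟩
      simp only [Finset.mem_filter, Finset.mem_univ, true_and]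
      field_simp
      linear_combination hw
  simp only [h, mul_add, mul_one, Finset.sum_add_distrib, quadraticChar_sum_zero hF, ← map_mul,
    zero_add]

/-- A double sum of a symmetric function, written in the elementary symmetric polynomials. -/
theorem sum_symmetric (hF : ringChar F ≠ 2) (g : F → F → ℤ) :
    ∑ x, ∑ y, g (x + y) (x * y)
      = ∑ s, ∑ p, g s p * (1 + quadraticChar F (s ^ 2 - 4 * p)) := by
  have h1 : ∀ x : F, ∑ y, g (x + y) (x * y) = ∑ s, g s (x * (s - x)) := by
    intro x
    have := sum_comp_mul_add one_ne_zero (-x) (fun y => g (x + y) (x * y))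
    rw [← this]
    refine Finset.sum_congr rfl fun s _ => ?_
    congr 1 <;> ring
  simp only [h1]
  rw [Finset.sum_comm]
  refine Finset.sum_congr rfl fun s _ => ?_
  rw [sum_comp_eq_sum_mul_card (fun x : F => x * (s - x)) (fun p => g s p)]
  refine Finset.sum_congr rfl fun p _ => ?_
  have e : s ^ 2 - 4 * p = (-s) ^ 2 - 4 * p := by ring
  rw [e, ← card_monic_quadratic_roots hF (-s) p]
  congr 3
  ext x
  simp only [Finset.mem_filter, Finset.mem_univ, true_and]
  constructor <;> intro h <;> linear_combination -h

end QuadraticCharacterSums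

/-! ### The square of the Clausen sum -/

section ClausenIdentity

variable {F : Type*} [Field F] [Fintype F] [DecidableEq F]

/-- The character sum of the surface `w² = -y (y - 1) (y - P) P (1 + l - l P)`. It is
`φ(1 + l) q² ₃F₂(l / (1 + l))` in Greene's normalization. -/
noncomputable def surfaceSum (l : F) : ℤ :=
  ∑ y, ∑ P, quadraticChar F (y * (y - 1) * (y - P) * (-P) * (1 + l - l * P))

theorem sum_quadraticChar_linear_mul_norm (hF : ringChar F ≠ 2) {l : F} (hl : l ≠ 0)
    (hl' : 1 + l ≠ 0) :
    ∑ s, ∑ p, quadraticChar F (p - s + 1) * quadraticChar F ((p - l) ^ 2 + l * s ^ 2)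
      = Fintype.card F := by
  have h1 : ∀ s : F,
      ∑ p, quadraticChar F (p - s + 1) * quadraticChar F ((p - l) ^ 2 + l * s ^ 2)
        = ∑ m, quadraticChar F (m ^ 2 + l) * quadraticChar F ((m - 1) * s + (1 + l)) := by
    intro s
    by_cases hs : s = 0
    · subst hs
      have e : ∀ p : F,
          quadraticChar F (p - 0 + 1) * quadraticChar F ((p - l) ^ 2 + l * 0 ^ 2)
            = quadraticChar F (p + 1) - if p = l then quadraticChar F (1 + l) else 0 := by
        intro p
        by_cases hp : p = l
        · subst hp; simp [add_comm]
        · have : (p - l) ^ 2 + l * 0 ^ 2 = (p - l) ^ 2 := by ring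
          rw [this, quadraticChar_sq_one' (sub_ne_zero.mpr hp), if_neg hp]
          simp
      have h0 := sum_quadraticChar_linear hF one_ne_zero (1 : F)
      simp only [one_mul] at h0
      rw [Finset.sum_congr rfl fun p _ => e p, Finset.sum_sub_distrib, h0]
      simp only [mul_zero, zero_add, ← Finset.sum_mul, sum_quadraticChar_sq_add hF hl]
      simp
    -- With p = s m + l the second factor is s² (m² + l), and the first becomes linear in s,
    -- constant only for m = 1.
    · rw [← sum_comp_mul_add hs l
        (fun p => quadraticChar F (p - s + 1) * quadraticChar F ((p - l) ^ 2 + l * s ^ 2))]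
      refine Finset.sum_congr rfl fun m _ => ?_
      rw [← quadraticChar_sq_mul hs (m ^ 2 + l), mul_comm]
      congr 2 <;> ring
  simp only [h1]
  rw [Finset.sum_comm]
  simp only [← Finset.mul_sum]
  rw [Finset.sum_eq_single 1]
  · simp only [sub_self, zero_mul, zero_add, one_pow, Finset.sum_const, Finset.card_univ,
      nsmul_eq_mul]
    have := quadraticChar_sq_one hl'
    linear_combination (Fintype.card F : ℤ) * this
  · intro m _ hm
    rw [sum_quadraticChar_linear hF (sub_ne_zero.mpr hm), mul_zero]
  · simp

/-- A quartic character sum rewritten through the discriminants of a pencil of quadratics. -/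
theorem sum_quadraticChar_quartic (hF : ringChar F ≠ 2) {l : F} (hl' : 1 + l ≠ 0) (c : F) :
    ∑ s, quadraticChar F (((s - 1 + c - l) ^ 2 + l * s ^ 2) * ((s - 2) ^ 2 - 4 * c))
      = ∑ z, quadraticChar F (z * (z - l) * (4 * c * z + (1 + l - c) ^ 2))
        - quadraticChar F (1 + l) := by
  have h2 := Ring.two_ne_zero hF
  set A : F → F := fun s => (s - 1 + c - l) ^ 2 + l * s ^ 2 with hA
  set B : F → F := fun s => (s - 2) ^ 2 - 4 * c with hB
  -- If B s ≠ 0, only z = A s / B s contributes. At a common zero every z does, and ∑ φ(z) = 0.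
  have h1 : ∀ s : F, quadraticChar F (A s * B s)
      = ∑ z, if A s - z * B s = 0 then quadraticChar F z else 0 := by
    intro s
    by_cases hBs : B s = 0
    · by_cases hAs : A s = 0
      · simp only [hAs, hBs, mul_zero, sub_zero, if_true]
        rw [quadraticChar_sum_zero hF, quadraticChar_zero]
      · simp [hAs, hBs]
    · rw [Finset.sum_eq_single (A s / B s)]
      · rw [if_pos (by field_simp; ring), ← quadraticChar_mul_sq (A s / B s) hBs]
        congr 1
        field_simp
      · intro z _ hz
        rw [if_neg]
        intro h
        exact hz (by rw [eq_div_iff hBs]; linear_combination -h)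
      · simp
  have hcard : ∀ z : F, ((Finset.univ.filter fun s : F => A s - z * B s = 0).card : ℤ)
      = 1 + quadraticChar F ((z - l) * (4 * c * z + (1 + l - c) ^ 2))
        - if z = 1 + l then 1 else 0 := by
    intro z
    -- A has leading coefficient 1 + l and B is monic, so here the degree drops and there is one
    -- root fewer than the discriminant predicts.
    by_cases hz : z = 1 + l
    · have e1 : (z - l) * (4 * c * z + (1 + l - c) ^ 2) = (1 + l + c) ^ 2 := by
        rw [hz]; ring
      have e2 : ∀ s, A s - z * B s = 2 * (1 + l + c) * s + ((1 + l + c) ^ 2 - 4 * (1 + l)) := by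
        intro s; simp only [hA, hB, hz]; ring
      simp only [e1, e2, if_pos hz]
      by_cases hc : 1 + l + c = 0
      · have h4 : (4 : F) * (1 + l) ≠ 0 := by
          have : (4 : F) = 2 * 2 := by norm_num
          rw [this]
          exact mul_ne_zero (mul_ne_zero h2 h2) hl'
        simp [hc, h4]
      · rw [quadraticChar_sq_one' hc]
        have h3 : (Finset.univ.filter fun s : F =>
            2 * (1 + l + c) * s + ((1 + l + c) ^ 2 - 4 * (1 + l)) = 0)
            = {-((1 + l + c) ^ 2 - 4 * (1 + l)) / (2 * (1 + l + c))} := by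
          ext s
          simp only [Finset.mem_filter, Finset.mem_univ, true_and, Finset.mem_singleton]
          rw [eq_div_iff (mul_ne_zero h2 hc)]
          constructor <;> intro h <;> linear_combination h
        rw [h3]
        simp
    · have := card_quadratic_roots hF (a := 1 + l - z) (sub_ne_zero.mpr (Ne.symm hz))
        (-2 * (1 + l - c) + 4 * z) ((1 + l - c) ^ 2 - z * (4 - 4 * c))
      have e : (-2 * (1 + l - c) + 4 * z) ^ 2
          - 4 * (1 + l - z) * ((1 + l - c) ^ 2 - z * (4 - 4 * c))
          = ((z - l) * (4 * c * z + (1 + l - c) ^ 2)) * 2 ^ 2 := by ring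
      rw [e, quadraticChar_mul_sq _ h2] at this
      rw [if_neg hz, sub_zero, ← this]
      congr 3
      ext s
      simp only [hA, hB]
      constructor <;> intro h <;> linear_combination h
  rw [Finset.sum_congr rfl fun s _ => h1 s, Finset.sum_comm]
  have h3 : ∀ z : F, (∑ s, if A s - z * B s = 0 then quadraticChar F z else 0)
      = quadraticChar F z + quadraticChar F (z * (z - l) * (4 * c * z + (1 + l - c) ^ 2))
        - if z = 1 + l then quadraticChar F (1 + l) else 0 := by
    intro z
    rw [← Finset.sum_filter, Finset.sum_const, nsmul_eq_mul, hcard z, mul_assoc z, map_mul _ z]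
    by_cases hz : z = 1 + l
    · simp only [hz, if_true]; ring
    · simp only [if_neg hz]; ring
  rw [Finset.sum_congr rfl fun z _ => h3 z, Finset.sum_sub_distrib, Finset.sum_add_distrib,
    quadraticChar_sum_zero hF]
  simp

theorem sum_quadraticChar_linear_mul_norm_mul_disc (hF : ringChar F ≠ 2) {l : F} (hl : l ≠ 0)
    (hl' : 1 + l ≠ 0) :
    ∑ s, ∑ p, quadraticChar F (p - s + 1) * quadraticChar F ((p - l) ^ 2 + l * s ^ 2)
        * quadraticChar F (s ^ 2 - 4 * p)
      = surfaceSum l := by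
  have h2 := Ring.two_ne_zero hF
  have h1 : ∀ s : F, ∑ p, quadraticChar F (p - s + 1)
        * quadraticChar F ((p - l) ^ 2 + l * s ^ 2) * quadraticChar F (s ^ 2 - 4 * p)
      = ∑ c, quadraticChar F c
        * quadraticChar F (((s - 1 + c - l) ^ 2 + l * s ^ 2) * ((s - 2) ^ 2 - 4 * c)) := by
    intro s
    -- The new variable is the linear factor c = p - s + 1.
    rw [← sum_comp_mul_add one_ne_zero (s - 1)]
    refine Finset.sum_congr rfl fun c _ => ?_
    rw [map_mul _ ((s - 1 + c - l) ^ 2 + l * s ^ 2), mul_assoc]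
    congr 2
    · ring
    · congr 1; ring
    · congr 1; ring
  simp only [h1]
  have h3 : ∀ c : F, ∑ s, quadraticChar F c
        * quadraticChar F (((s - 1 + c - l) ^ 2 + l * s ^ 2) * ((s - 2) ^ 2 - 4 * c))
      = ∑ z, quadraticChar F (c * (z * (z - l) * (4 * c * z + (1 + l - c) ^ 2)))
        - quadraticChar F c * quadraticChar F (1 + l) := by
    intro c
    rw [← Finset.mul_sum, sum_quadraticChar_quartic hF hl', mul_sub, Finset.mul_sum]
    simp only [← map_mul]
  rw [Finset.sum_comm, Finset.sum_congr rfl fun c _ => h3 c, Finset.sum_sub_distrib,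
    ← Finset.sum_mul, quadraticChar_sum_zero hF, zero_mul, sub_zero]
  rw [Finset.sum_comm, surfaceSum, ← sum_comp_mul_add hl 0]
  refine Finset.sum_congr rfl fun y _ => ?_
  have h4 : ∀ c : F,
      quadraticChar F (c * ((l * y + 0) * (l * y + 0 - l)
        * (4 * c * (l * y + 0) + (1 + l - c) ^ 2)))
      = quadraticChar F (y * (y - 1))
        * quadraticChar F (c * (c ^ 2 + (4 * (l * y) - 2 * (1 + l)) * c + (1 + l) ^ 2)) := by
    intro c
    rw [← map_mul, ← quadraticChar_sq_mul hl (y * (y - 1) * _)]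
    congr 1
    ring
  rw [Finset.sum_congr rfl fun c _ => h4 c, ← Finset.mul_sum]
  -- The isogenous cubic in v splits, since b = (1 + l)² is a square; v = 4l(y - P) puts its roots
  -- at P = y, 0 and (1 + l)/l.
  have h5 : -(2 ^ 2 * l) ≠ 0 := neg_ne_zero.mpr (mul_ne_zero (pow_ne_zero 2 h2) hl)
  rw [sum_quadraticChar_two_isogeny hF _ (pow_ne_zero 2 hl'),
    ← sum_comp_mul_add h5 (4 * l * y), Finset.mul_sum]
  refine Finset.sum_congr rfl fun P _ => ?_
  rw [← map_mul, ← quadraticChar_sq_mul (mul_ne_zero (pow_ne_zero 3 h2) hl)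
    (y * (y - 1) * (y - P) * _ * _)]
  congr 1
  ring

theorem sum_sq_eq_card_add_surfaceSum (hF : ringChar F ≠ 2) {l : F} (hl : l ≠ 0)
    (hl' : 1 + l ≠ 0) :
    (∑ x, quadraticChar F ((x - 1) * (x ^ 2 + l))) ^ 2 = Fintype.card F + surfaceSum l := by
  rw [← sum_quadraticChar_linear_mul_norm hF hl hl',
    ← sum_quadraticChar_linear_mul_norm_mul_disc hF hl hl', sq, Finset.sum_mul_sum]
  have := sum_symmetric hF fun s p : F =>
    quadraticChar F (p - s + 1) * quadraticChar F ((p - l) ^ 2 + l * s ^ 2)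
  simp only [mul_add, mul_one, Finset.sum_add_distrib] at this
  rw [← this]
  refine Finset.sum_congr rfl fun x _ => Finset.sum_congr rfl fun y _ => ?_
  simp only [← map_mul]
  congr 1
  ring

end ClausenIdentity

/-! ### Traces of Frobenius as character sums -/

section PointCounts

variable {F : Type*} [Field F] [Fintype F] [DecidableEq F]

theorem frobTrace_eq_neg_sum (hF : ringChar F ≠ 2) (E : WeierstrassCurve F) (hE : E.Δ ≠ 0)
    (f : F → F) (hf : ∀ x y, E.toAffine.Equation x y ↔ y ^ 2 = f x) :
    GaussHyp.frobTrace E = -∑ x, quadraticChar F (f x) := by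
  let e : E.toAffine.Point ≃ Option (Σ x : F, {y : F // y ^ 2 = f x}) :=
    { toFun := fun P => match P with
        | .zero => none
        | .some x y h => some ⟨x, y, (hf x y).mp h.1⟩
      invFun := fun P => match P with
        | none => .zero
        | some ⟨x, y, h⟩ => .some x y
            ((WeierstrassCurve.Affine.equation_iff_nonsingular_of_Δ_ne_zero hE).mp
              ((hf x y).mpr h))
      left_inv := by rintro (_ | ⟨x, y, h⟩) <;> rfl
      right_inv := by rintro (_ | ⟨x, y, h⟩) <;> rfl }
  have hcard : ∀ x : F, (Fintype.card {y : F // y ^ 2 = f x} : ℤ)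
      = quadraticChar F (f x) + 1 := by
    intro x
    rw [← quadraticChar_card_sqrts hF (f x), Set.toFinset_card]
    rfl
  rw [GaussHyp.frobTrace, Nat.card_congr e, Nat.card_eq_fintype_card, Fintype.card_option,
    Fintype.card_sigma]
  push_cast
  simp only [hcard, Finset.sum_add_distrib, Finset.sum_const, Finset.card_univ, nsmul_eq_mul]
  ring

theorem legendreTrace_eq (hF : ringChar F ≠ 2) {l : F} (h0 : l ≠ 0) (h1 : l ≠ 1) :
    GaussHyp.legendreTrace l = -∑ x, quadraticChar F (x * (x - 1) * (x - l)) := by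
  refine frobTrace_eq_neg_sum hF _ ?_ _ (GaussHyp.legendreCurve_equation_iff l)
  have h16 : (16 : F) = 2 ^ 4 := by norm_num
  rw [GaussHyp.legendreCurve_Δ, h16]
  exact mul_ne_zero (pow_ne_zero _ (Ring.two_ne_zero hF))
    (mul_ne_zero (pow_ne_zero _ h0) (pow_ne_zero _ (sub_ne_zero.mpr h1)))

theorem clausenTrace_eq (hF : ringChar F ≠ 2) {l : F} (h0 : l ≠ 0) (h1 : l ≠ -1) :
    GaussHyp.clausenTrace l = -∑ x, quadraticChar F ((x - 1) * (x ^ 2 + l)) := by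
  refine frobTrace_eq_neg_sum hF _ ?_ _ (GaussHyp.clausenCurve_equation_iff l)
  have h64 : (-64 : F) = -2 ^ 6 := by norm_num
  rw [GaussHyp.clausenCurve_Δ, h64]
  exact mul_ne_zero (neg_ne_zero.mpr (pow_ne_zero _ (Ring.two_ne_zero hF)))
    (mul_ne_zero h0 (pow_ne_zero _ fun h => h1 (eq_neg_of_add_eq_zero_left h)))

/-- The finite field form of Clausen's formula. -/
theorem clausenTrace_sq (hF : ringChar F ≠ 2) {l : F} (h0 : l ≠ 0) (h1 : l ≠ -1) :
    GaussHyp.clausenTrace l ^ 2 = Fintype.card F + surfaceSum l := by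
  rw [clausenTrace_eq hF h0 h1, neg_sq, sum_sq_eq_card_add_surfaceSum hF h0]
  exact fun h => h1 (eq_neg_of_add_eq_zero_right h)

end PointCounts

/-! ### Sums over the parameter λ -/

section Moments

variable {F : Type*} [Field F] [Fintype F] [DecidableEq F]

/-- For fixed x the sum over all l vanishes, so only the omitted terms l = 0 and l = 1 count; up to
sign they are φ(x - 1) for x ≠ 0 and φ(x) for x ≠ 1. -/
theorem sum_legendreTrace (hF : ringChar F ≠ 2) :
    ∑ l ∈ Finset.univ.filter (fun l : F => l ≠ 0 ∧ l ≠ 1), GaussHyp.legendreTrace l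
      = -1 - quadraticChar F (-1) := by
  have h1 : ∀ x : F, ∑ l ∈ Finset.univ.filter (fun l : F => l ≠ 0 ∧ l ≠ 1),
        quadraticChar F (x * (x - 1) * (x - l))
      = - (quadraticChar F (1 * x + -1) - (if x = 0 then quadraticChar F (-1) else 0))
        - (quadraticChar F x - (if x = 1 then 1 else 0)) := by
    intro x
    have h := sum_quadraticChar_linear hF (neg_ne_zero.mpr one_ne_zero) x
    simp only [neg_one_mul, neg_add_eq_sub] at h
    rw [sum_filter_ne_ne _ _ zero_ne_one]
    simp only [map_mul _ (x * (x - 1)), ← Finset.mul_sum, h]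
    by_cases hx : x = 0
    · simp [hx]
    by_cases hx1 : x = 1
    · simp [hx1]
    have e0 := quadraticChar_sq_one hx
    have e1 := quadraticChar_sq_one (sub_ne_zero.mpr hx1)
    simp only [hx, hx1, if_false, map_mul, sub_zero, one_mul, ← sub_eq_add_neg]
    linear_combination (-quadraticChar F (x - 1)) * e0 - quadraticChar F x * e1
  have h2 := sum_quadraticChar_linear hF one_ne_zero (-1 : F)
  rw [Finset.sum_congr rfl fun l hl =>
    legendreTrace_eq hF (Finset.mem_filter.mp hl).2.1 (Finset.mem_filter.mp hl).2.2,
    Finset.sum_neg_distrib, Finset.sum_comm, Finset.sum_congr rfl fun x _ => h1 x]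
  simp only [Finset.sum_sub_distrib, Finset.sum_neg_distrib, h2, quadraticChar_sum_zero hF]
  simp
  ring

/-- The integer `q² ₃F₂(1)` as a character sum. -/
noncomputable def surfaceSumOne (F : Type*) [Field F] [Fintype F] [DecidableEq F] : ℤ :=
  ∑ y : F, ∑ P : F, quadraticChar F (y * (y - 1) * (y - P) * (-P) * (1 - P))

theorem sum_quadraticChar_mul_surfaceSum (w : F → F) (s : Finset F)
    (g : F → ℤ)
    (h : ∀ P, P ≠ 0 → ∑ l ∈ s, quadraticChar F (w l * (1 + l - l * P)) = g P) :
    ∑ l ∈ s, quadraticChar F (w l) * surfaceSum l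
      = ∑ y, ∑ P, quadraticChar F (y * (y - 1) * (y - P) * (-P)) * g P := by
  simp only [surfaceSum, Finset.mul_sum]
  rw [Finset.sum_comm]
  refine Finset.sum_congr rfl fun y _ => ?_
  rw [Finset.sum_comm]
  refine Finset.sum_congr rfl fun P _ => ?_
  by_cases hP : P = 0
  · simp [hP]
  · rw [← h P hP, Finset.mul_sum]
    refine Finset.sum_congr rfl fun l _ => ?_
    simp only [← map_mul]
    congr 1
    ring

theorem sum_one_add_mul_surfaceSum (hF : ringChar F ≠ 2) :
    ∑ l ∈ Finset.univ.filter (fun l : F => l ≠ 0 ∧ l ≠ -1), quadraticChar F (1 + l) * surfaceSum l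
      = -1 - surfaceSumOne F := by
  rw [sum_quadraticChar_mul_surfaceSum (fun l => 1 + l) _
    (fun P => -1 - quadraticChar F (1 - P))]
  · have h1 : ∀ y : F, ∑ P, quadraticChar F (y * (y - 1) * (y - P) * (-P))
        = -quadraticChar F (y * (y + -1)) := by
      intro y
      by_cases hy : y = 0
      · simp [hy]
      · have := sum_quadraticChar_mul_add hF (neg_ne_zero.mpr hy)
        have e : ∀ P : F, y * (y - 1) * (y - P) * (-P) = y * (y + -1) * (P * (P + -y)) := by
          intro P; ring
        simp only [e, map_mul _ (y * (y + -1)), ← Finset.mul_sum, this]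
        ring
    simp only [@mul_sub ℤ, Finset.sum_sub_distrib, @mul_neg ℤ, @mul_one ℤ,
      Finset.sum_neg_distrib, h1,
      sum_quadraticChar_mul_add hF (neg_ne_zero.mpr (one_ne_zero (α := F))), surfaceSumOne,
      ← map_mul]
    ring
  · intro P hP
    have h := sum_quadraticChar_linear hF hP (1 - P)
    rw [← sum_comp_inv, ← sum_comp_mul_add one_ne_zero 1] at h
    -- Multiply by (1 + x)². At x = -1 the convention 0⁻¹ = 0 leaves the extra value φ(1 - P).
    have e : ∀ x : F, quadraticChar F (P * (1 * x + 1)⁻¹ + (1 - P))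
        = quadraticChar F ((1 + x) * (1 + x - x * P))
          + if x = -1 then quadraticChar F (1 - P) else 0 := by
      intro x
      by_cases hx : x = -1
      · simp [hx]
      · have hx' : 1 + x ≠ 0 := fun h => hx (eq_neg_of_add_eq_zero_right h)
        rw [if_neg hx, add_zero, one_mul, add_comm x 1, ← quadraticChar_sq_mul hx' (P * _ + _)]
        congr 1
        field_simp
        ring
    rw [Finset.sum_congr rfl fun x _ => e x, Finset.sum_add_distrib] at h
    rw [sum_filter_ne_ne _ _ (by simp)]
    simp at h ⊢
    linear_combination h

theorem sum_mul_surfaceSum (hF : ringChar F ≠ 2) :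
    ∑ l ∈ Finset.univ.filter (fun l : F => l ≠ 0 ∧ l ≠ -1), quadraticChar F l * surfaceSum l
      = -quadraticChar F (-1) - surfaceSumOne F := by
  rw [sum_quadraticChar_mul_surfaceSum (fun l => l) _
    (fun P => -quadraticChar F (-P) - quadraticChar F (1 - P))]
  · have h1 : ∀ y : F, ∑ P, quadraticChar F (y * (y - 1) * (y - P) * (-P)) * quadraticChar F (-P)
        = -quadraticChar F (1 * y + -1) + if y = 0 then quadraticChar F (-1) else 0 := by
      intro y
      by_cases hy : y = 0
      · simp [hy]
      · have := sum_quadraticChar_linear hF (neg_ne_zero.mpr one_ne_zero) y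
        have e : ∀ P : F, quadraticChar F (y * (y - 1) * (y - P) * (-P)) * quadraticChar F (-P)
            = quadraticChar F (y * (y - 1)) * (quadraticChar F (-1 * P + y)
              - if P = 0 then quadraticChar F y else 0) := by
          intro P
          by_cases hP : P = 0
          · simp [hP]
          · rw [if_neg hP, sub_zero, ← map_mul, ← map_mul,
              ← quadraticChar_sq_mul hP (y * (y - 1) * _)]
            congr 1
            ring
        have e0 := quadraticChar_sq_one hy
        simp only [e, ← Finset.mul_sum, Finset.sum_sub_distrib, this]
        simp only [Finset.sum_ite_eq', Finset.mem_univ, if_true, if_neg hy, map_mul, one_mul,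
          ← sub_eq_add_neg]
        linear_combination (-quadraticChar F (y - 1)) * e0
    simp only [@mul_sub ℤ, Finset.sum_sub_distrib, @mul_neg ℤ, Finset.sum_neg_distrib, h1,
      Finset.sum_add_distrib, sum_quadraticChar_linear hF one_ne_zero, surfaceSumOne]
    simp only [← map_mul, Finset.sum_ite_eq', Finset.mem_univ, if_true]
    ring
  · intro P hP
    have h := sum_quadraticChar_linear hF one_ne_zero (1 - P)
    rw [← sum_comp_inv] at h
    have e : ∀ x : F, quadraticChar F (1 * x⁻¹ + (1 - P))
        = quadraticChar F (x * (1 + x - x * P)) + if x = 0 then quadraticChar F (1 - P) else 0 := by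
      intro x
      by_cases hx : x = 0
      · simp [hx]
      · rw [if_neg hx, add_zero, ← quadraticChar_sq_mul hx (1 * _ + _)]
        congr 1
        field_simp
        ring
    rw [Finset.sum_congr rfl fun x _ => e x, Finset.sum_add_distrib] at h
    rw [sum_filter_ne_ne _ _ (by simp)]
    simp at h ⊢
    linear_combination h

end Moments

/-! ### The value of ₃F₂ at 1 -/

section HypergeometricAtOne

variable {F : Type*} [Field F] [Fintype F] [DecidableEq F]

theorem sum_mulChar_apply (a : F) :
    ∑ χ : MulChar F ℂ, χ a = if a = 1 then (Fintype.card F : ℂ) - 1 else 0 := by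
  split_ifs with ha
  · have h := MulChar.card_eq_card_units_of_hasEnoughRootsOfUnity F ℂ
    rw [Nat.card_eq_fintype_card, Nat.card_eq_fintype_card] at h
    simp only [ha, map_one, Finset.sum_const, Finset.card_univ, h, nsmul_eq_mul, mul_one]
    rw [Fintype.card_eq_card_units_add_one (α := F)]
    push_cast
    ring
  · obtain ⟨χ, hχ⟩ := MulChar.exists_apply_ne_one_of_hasEnoughRootsOfUnity F ℂ ha
    refine eq_zero_of_mul_eq_self_left hχ ?_
    simp only [Finset.mul_sum, ← MulChar.mul_apply]
    exact Fintype.sum_bijective _ (Group.mulLeft_bijective χ) _ _ fun χ' => rfl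

theorem phi_apply (x : F) : GaussHyp.phi F x = (quadraticChar F x : ℂ) := rfl

theorem charBinom_phi_mul (χ : MulChar F ℂ) :
    GaussHyp.charBinom (GaussHyp.phi F * χ) χ
      = (Fintype.card F : ℂ)⁻¹ * ∑ s, (quadraticChar F (s * (s - 1)) : ℂ) * χ s := by
  rw [GaussHyp.charBinom, jacobiSum, div_eq_inv_mul, mul_assoc, Finset.mul_sum]
  congr 1
  -- This is u ↦ u / (u - 1) for u ≠ 1. As 0⁻¹ = 0 it fixes 1, where both summands vanish.
  have hb : Function.Bijective fun u : F => (u - 1)⁻¹ + 1 :=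
    (Equiv.addRight (1 : F)).bijective.comp
      (inv_involutive.bijective.comp (Equiv.subRight (1 : F)).bijective)
  rw [← hb.sum_comp fun s => (quadraticChar F (s * (s - 1)) : ℂ) * χ s]
  refine Finset.sum_congr rfl fun u _ => ?_
  rw [MulChar.mul_apply, MulChar.inv_apply', phi_apply]
  by_cases hu : u = 1
  · simp [hu, MulChar.map_zero]
  have hu1 : u - 1 ≠ 0 := sub_ne_zero.mpr hu
  have hu1' : 1 - u ≠ 0 := sub_ne_zero.mpr (Ne.symm hu)
  have e1 : (u - 1)⁻¹ + 1 = -1 * u * (1 - u)⁻¹ := by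
    have : u - 1 = -(1 - u) := by ring
    rw [this, inv_neg]
    field_simp
    ring
  have e2 : quadraticChar F (((u - 1)⁻¹ + 1) * ((u - 1)⁻¹ + 1 - 1)) = quadraticChar F u := by
    rw [← quadraticChar_sq_mul hu1 (_ * _)]
    congr 1
    field_simp
    ring
  rw [e2, e1, map_mul, map_mul]
  ring

/-- Expanding the three binomials, orthogonality over χ keeps only s t r = 1 and yields a factor q -
1 that cancels the prefactor. The surface appears with y = s, P = s t, r = 1 / P. -/
theorem card_sq_mul_hypPhi_two_one :
    (Fintype.card F : ℂ) ^ 2 * GaussHyp.hypPhi 2 (1 : F) = surfaceSumOne F := by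
  have hq : (Fintype.card F : ℂ) ≠ 0 := Nat.cast_ne_zero.mpr Fintype.card_ne_zero
  have hq1 : (Fintype.card F : ℂ) - 1 ≠ 0 := by
    rw [sub_ne_zero]
    exact_mod_cast (Fintype.one_lt_card (α := F)).ne'
  set k : F → ℂ := fun s => (quadraticChar F (s * (s - 1)) : ℂ) with hk
  have h1 : ∀ χ : MulChar F ℂ, (∑ s, k s * χ s) * ((∑ t, k t * χ t) * ∑ r, k r * χ r)
      = ∑ s, ∑ t, ∑ r, k s * k t * k r * χ (s * t * r) := by
    intro χ
    rw [Finset.sum_mul_sum, Finset.sum_mul_sum]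
    refine Finset.sum_congr rfl fun s _ => ?_
    refine Finset.sum_congr rfl fun t _ => ?_
    rw [Finset.mul_sum]
    refine Finset.sum_congr rfl fun r _ => ?_
    rw [map_mul, map_mul]
    ring
  have h2 : ∀ s : F, ∑ t, ∑ r, k s * k t * k r * ∑ χ : MulChar F ℂ, χ (s * t * r)
      = ((Fintype.card F : ℂ) - 1) *
        ∑ P, (quadraticChar F (s * (s - 1) * (s - P) * (-P) * (1 - P)) : ℂ) := by
    intro s
    by_cases hs : s = 0
    · simp [hs, hk]
    rw [← sum_comp_mul_add hs 0 fun P =>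
      (quadraticChar F (s * (s - 1) * (s - P) * (-P) * (1 - P)) : ℂ), Finset.mul_sum]
    refine Finset.sum_congr rfl fun t _ => ?_
    rw [add_zero]
    by_cases ht : t = 0
    · simp [ht, hk]
    have hst : s * t ≠ 0 := mul_ne_zero hs ht
    rw [Finset.sum_eq_single (s * t)⁻¹]
    · rw [sum_mulChar_apply, if_pos (mul_inv_cancel₀ hst), mul_comm]
      congr 1
      simp only [hk]
      norm_cast
      rw [← map_mul, ← map_mul, ← quadraticChar_sq_mul (mul_ne_zero hs hst)
        (s * (s - 1) * (t * (t - 1)) * _)]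
      congr 1
      field_simp
      ring
    · intro r _ hr
      rw [sum_mulChar_apply, if_neg, mul_zero]
      exact fun h => hr (eq_inv_of_mul_eq_one_right h)
    · simp
  have h3 : ∑ χ : MulChar F ℂ, (∑ s, k s * χ s) * ((∑ t, k t * χ t) * ∑ r, k r * χ r)
      = ((Fintype.card F : ℂ) - 1) * surfaceSumOne F := by
    simp only [h1]
    rw [Finset.sum_comm, surfaceSumOne]
    push_cast
    rw [Finset.mul_sum]
    refine Finset.sum_congr rfl fun s _ => ?_
    rw [← h2 s, Finset.sum_comm]
    refine Finset.sum_congr rfl fun t _ => ?_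
    rw [Finset.sum_comm]
    refine Finset.sum_congr rfl fun r _ => ?_
    rw [Finset.mul_sum]
  have h4 : ∀ χ : MulChar F ℂ, ((Fintype.card F : ℂ)⁻¹ * ∑ s, k s * χ s)
      * (((Fintype.card F : ℂ)⁻¹ * ∑ s, k s * χ s) * ((Fintype.card F : ℂ)⁻¹ * ∑ s, k s * χ s))
      = (Fintype.card F : ℂ)⁻¹ ^ 3 *
        ((∑ s, k s * χ s) * ((∑ t, k t * χ t) * ∑ r, k r * χ r)) := by
    intro χ; ring
  simp only [GaussHyp.hypPhi, GaussHyp.hyp, Fin.prod_univ_two, one_mul, charBinom_phi_mul,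
    map_one, mul_one]
  rw [Finset.sum_congr rfl fun χ _ => h4 χ, ← Finset.mul_sum, h3]
  field_simp

end HypergeometricAtOne

/-! ### Assembly of the three identities -/

section Main

variable {F : Type*} [Field F] [Fintype F] [DecidableEq F]

theorem sum_weight_mul_clausenTrace_sq (hF : ringChar F ≠ 2) (w : F → F) :
    ∑ l ∈ Finset.univ.filter (fun l : F => l ≠ 0 ∧ l ≠ -1),
        quadraticChar F (w l) * GaussHyp.clausenTrace l ^ 2
      = Fintype.card F * (∑ l, quadraticChar F (w l) - quadraticChar F (w 0)
          - quadraticChar F (w (-1)))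
        + ∑ l ∈ Finset.univ.filter (fun l : F => l ≠ 0 ∧ l ≠ -1),
          quadraticChar F (w l) * surfaceSum l := by
  rw [← sum_filter_ne_ne 0 (-1) (by simp) (fun l => quadraticChar F (w l)), Finset.mul_sum,
    ← Finset.sum_add_distrib]
  refine Finset.sum_congr rfl fun l hl => ?_
  obtain ⟨-, h0, h1⟩ := Finset.mem_filter.mp hl
  rw [clausenTrace_sq hF h0 h1]
  ring

end Main

theorem corollary4p4 {F : Type*} [Field F] [Fintype F] [DecidableEq F] (hF : ringChar F ≠ 2) :
    ((∑ l ∈ Finset.univ.filter (fun l : F => l ≠ 0 ∧ l ≠ 1), (GaussHyp.legendreTrace l : ℂ))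
        + GaussHyp.phi F (-1) = -1) ∧
    ((∑ l ∈ Finset.univ.filter (fun l : F => l ≠ 0 ∧ l ≠ -1),
          GaussHyp.phi F (1 + l) * (GaussHyp.clausenTrace l : ℂ) ^ 2)
        + (Fintype.card F : ℂ)
        + (Fintype.card F : ℂ) ^ 2 * GaussHyp.hypPhi 2 (1 : F) = -1) ∧
    ((∑ l ∈ Finset.univ.filter (fun l : F => l ≠ 0 ∧ l ≠ -1),
          GaussHyp.phi F l * (GaussHyp.clausenTrace l : ℂ) ^ 2)
        + (Fintype.card F : ℂ) * GaussHyp.phi F (-1)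
        + (Fintype.card F : ℂ) ^ 2 * GaussHyp.hypPhi 2 (1 : F) = -GaussHyp.phi F (-1)) := by
  simp only [card_sq_mul_hypPhi_two_one, phi_apply]
  refine ⟨?_, ?_, ?_⟩
  · have h := congrArg (Int.cast : ℤ → ℂ) (sum_legendreTrace hF)
    push_cast at h
    rw [h]
    ring
  · have h := sum_quadraticChar_linear hF one_ne_zero (1 : F)
    simp only [one_mul, add_comm _ (1 : F)] at h
    have h' := sum_weight_mul_clausenTrace_sq hF (fun l => 1 + l)
    rw [sum_one_add_mul_surfaceSum hF, h, add_zero, add_neg_cancel, map_one,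
      quadraticChar_zero] at h'
    have h'' := congrArg (Int.cast : ℤ → ℂ) h'
    push_cast at h''
    rw [h'']
    ring
  · have h' := sum_weight_mul_clausenTrace_sq hF (fun l => l)
    rw [sum_mul_surfaceSum hF, quadraticChar_sum_zero hF, quadraticChar_zero] at h'
    have h'' := congrArg (Int.cast : ℤ → ℂ) h'
    push_cast at h''
    rw [h'']
    ring
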